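/- **Model.** Let $X=\{1,\dots,K\}$ be a finite set of initial values and let $Y$ be a finite set of outputs with a distinguished element $\emptyset\in Y$. A family of automata $(A_d)_{d}$ consists of a finite message set $M\ni\emptyset$ (the same for all $d$), finite memory sets $Z_d\ni\emptyset$ with $\log|Z_d|\le Cd$ for all $d\ge 1$ and some constant $C$, and transition maps $A_d: X\times Z_d\times Y\times M^d\to Z_d\times Y\times M^d$. (The automaton $A_0$ is used only on the one-node network.) On a finite connected undirected simple graph $G$, in which every node $i$ labels its incident edges by the port numbers $1,\dots,\deg(i)$, each node $i$ with initial value $x_i\in X$ runs $A_{\deg(i)}$ synchronously, starting with memory, output and messages all equal to $\emptyset$: if $j_k$ is the neighbor of $i$ at port $k$ of $i$, and $p_k$ is the port number at $j_k$ of the edge leading to $i$, then $$[z_i(t+1),y_i(t+1);m_{i,1}(t+1),\dots,m_{i,\deg(i)}(t+1)]=A_{\deg(i)}[x_i,z_i(t),y_i(t);m_{j_1,p_1}(t),\dots,m_{j_{\deg(i)},p_{\deg(i)}}(t)].$$ A family of functions $f_n:X^n\to Y$, $n\ge 1$, is *computable* if there is a family of automata such that for every $n$, every connected graph with $n$ nodes,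 every port labeling and all initial values $x\in X^n$, there is a time after which the outputs $y_i(t)$ of all nodes equal $f_n(x)$. Let $D=\{p\in[0,1]^K:\sum_{k=1}^K p_k=1\}$. A function $h:D\to Y$ is *computable* if the family $f_n(x)=h(p_1(x),\dots,p_K(x))$, where $p_k(x)=|\{i: x_i=k\}|/n$, is computable. **Theorem.** Let $h:D\to Y$ be a function such that every level set $L(y)=\{p\in D: h(p)=y\}$, $y\in Y$, is a finite union of sets, each of which is the intersection with $D$ of the solution sets of finitely many linear inequalities of the form $\alpha_1p_1+\dots+\alpha_Kp_K\le\alpha$ or $\alpha_1p_1+\dots+\alpha_Kp_K<\alpha$ with rational $\alpha,\alpha_1,\dots,\alpha_K$. Then $h$ is computable. -/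

import Mathlib

namespace AnonNet

/-- A family of finite automata, one for each node degree `d`, with initial values in `X` and
outputs in `Y`. `Z d` is the set of internal memory states of a node of degree `d`, `M` is the set
of messages (the same for all degrees), and `z0 d`, `m0` are the distinguished elements (written
`∅` on paper) in which memory and messages start. The automaton never changes the initial value,
so `step` only returns the new memory state, output and outgoing messages (one for each port).
The number of bits of memory of a node is at most proportional to its degree. The automaton of
degree `0` is only used on the network with a single node. -/
structure AutomatonFamily (X Y : Type*) where
  Z : ℕ → Type
  M : Type
  finite_Z : ∀ d, Finite (Z d)
  finite_M : Finite M
  z0 : ∀ d, Z d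
  m0 : M
  step : ∀ d, X → Z d → Y → (Fin d → M) → Z d × Y × (Fin d → M)
  memory_bound : ∃ C : ℝ, ∀ d : ℕ, 1 ≤ d → Real.log (Nat.card (Z d)) ≤ C * d

/-- The changing part of the state of a node of degree `d`: memory, output, and the messages it
currently sends, indexed by its ports. -/
abbrev AutomatonFamily.State {X Y : Type*} (A : AutomatonFamily X Y) (d : ℕ) : Type _ :=
  A.Z d × Y × (Fin d → A.M)

/-- A port labeling: each node numbers its incident edges, equivalently its neighbors. -/
abbrev PortLabeling {V : Type*} (G : SimpleGraph V) [G.LocallyFinite] : Type _ :=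
  ∀ i : V, Fin (G.degree i) ≃ G.neighborSet i

/-- The synchronous dynamics. At time `0` every node `i` has memory `z0`, output `y0` and
messages `m0`. At each round, node `i` receives at its port `k` the message which the neighbor
`j` behind that port sent into the port of `j` leading to `i`. -/
def AutomatonFamily.run {X Y V : Type*} (A : AutomatonFamily X Y) (y0 : Y)
    (G : SimpleGraph V) [G.LocallyFinite] (port : PortLabeling G) (x : V → X) :
    ℕ → ∀ i : V, A.State (G.degree i)
  | 0 => fun i => (A.z0 (G.degree i), y0, fun _ => A.m0)
  | t + 1 => fun i =>
      A.step (G.degree i) (x i)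
        (A.run y0 G port x t i).1
        (A.run y0 G port x t i).2.1
        (fun k =>
          (A.run y0 G port x t (port i k : V)).2.2
            ((port (port i k : V)).symm ⟨i, SimpleGraph.Adj.symm (port i k).2⟩))

/-- `y` is the final output: from some time on, all nodes have output `y`. -/
def AutomatonFamily.IsFinalOutput {X Y V : Type*} (A : AutomatonFamily X Y) (y0 : Y)
    (G : SimpleGraph V) [G.LocallyFinite] (port : PortLabeling G) (x : V → X) (y : Y) : Prop :=
  ∃ T : ℕ, ∀ t, T ≤ t → ∀ i : V, (A.run y0 G port x t i).2.1 = y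

/-- Computability of a family of functions `f n : X ^ n → Y`, the outputs starting at `y0`: a
single family of automata has final output `f n x` on every connected network with `n` nodes, for
every port labeling and all initial values `x`. (There is no connected network with `0` nodes, so
`f 0` plays no role.) -/
def IsComputableFamily {X Y : Type*} (y0 : Y) (f : ∀ n : ℕ, (Fin n → X) → Y) : Prop :=
  ∃ A : AutomatonFamily X Y,
    ∀ (n : ℕ) (G : SimpleGraph (Fin n)) [G.LocallyFinite], G.Connected →
      ∀ (port : PortLabeling G) (x : Fin n → X), A.IsFinalOutput y0 G port x (f n x)

/-- The frequency with which the value `k` occurs in `x`. -/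
noncomputable def freq {K n : ℕ} (x : Fin n → Fin K) (k : Fin K) : ℝ :=
  (Finset.card {i | x i = k} : ℝ) / n

theorem freq_mem {K n : ℕ} (hn : 0 < n) (x : Fin n → Fin K) :
    freq x ∈ stdSimplex ℝ (Fin K) := by
  refine ⟨fun k => by unfold freq; positivity, ?_⟩
  have h1 : ∑ k : Fin K, Finset.card {i | x i = k} = n := by
    have h2 := Finset.card_eq_sum_card_fiberwise (f := x) (s := Finset.univ) (t := Finset.univ)
      (by simp)
    simpa using h2.symm
  have hn' : (n : ℝ) ≠ 0 := by positivity
  unfold freq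
  rw [← Finset.sum_div, ← Nat.cast_sum, h1, div_self hn']

/-- `h` corresponds to the family `f`: the value of `f n` is `h` of the vector of frequencies. -/
def Corresponds {K : ℕ} {Y : Type*} (h : stdSimplex ℝ (Fin K) → Y)
    (f : ∀ n : ℕ, (Fin n → Fin K) → Y) : Prop :=
  ∀ (n : ℕ) (hn : 0 < n) (x : Fin n → Fin K), f n x = h ⟨freq x, freq_mem hn x⟩

/-- A function on the proportion set is computable if it corresponds to a computable family. -/
def IsComputable {K : ℕ} {Y : Type*} (y0 : Y) (h : stdSimplex ℝ (Fin K) → Y) : Prop :=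
  ∃ f : ∀ n : ℕ, (Fin n → Fin K) → Y, Corresponds h f ∧ IsComputableFamily y0 f

/-- A linear inequality with rational coefficients, strict or not. -/
structure RatLinIneq (K : ℕ) where
  coeff : Fin K → ℚ
  bound : ℚ
  strict : Bool

/-- The points of the proportion set that satisfy the inequality. -/
def RatLinIneq.solutions {K : ℕ} (c : RatLinIneq K) : Set (stdSimplex ℝ (Fin K)) :=
  {p | if c.strict then ∑ k, (c.coeff k : ℝ) * (p : Fin K → ℝ) k < (c.bound : ℝ)
    else ∑ k, (c.coeff k : ℝ) * (p : Fin K → ℝ) k ≤ (c.bound : ℝ)}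

/-- Finite unions of finite intersections of solution sets of rational linear inequalities. -/
def IsRatPolyhedral {K : ℕ} (L : Set (stdSimplex ℝ (Fin K))) : Prop :=
  ∃ (m : ℕ) (r : Fin m → ℕ) (c : ∀ i : Fin m, Fin (r i) → RatLinIneq K),
    L = ⋃ i : Fin m, ⋂ j : Fin (r i), (c i j).solutions

end AnonNet

/-! After clearing denominators, each linear inequality becomes the question whether a sum of
bounded integer weights, one per node, is at most zero. Finitely many such answers determine `h`, so
it suffices that every node eventually knows them.

To compare a sum with a threshold `θ ∈ {0, 1}`, a node of weight at least `θ` stores it as a value,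
and any other node issues a token carrying its debt. Tokens wander and are paid off by the values
they meet. Total value minus total debt is invariant, while the number of tokens and each value
never increase, so both stabilize. If no token is left, some node still holds at least `θ`, hence so
does the sum. If tokens remain, the rotor at each node sends them through all ports, so every node
is visited infinitely often; all values are then zero and the sum is below `θ`. This is
`token_dichotomy`.

Each sum is tested twice: the weights `W` against `1` and `-W` against `0`. Exactly one of these
dynamics dies out and the other keeps visiting every node, so the kind of the latest visiting token
is eventually the right answer everywhere (`signAutomaton_isFinalOutput`). Values and debts never
grow, so they stay bounded; only the rotor depends on the degree. -/

namespace AnonNet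

/-! ### Tokens meeting a single node. -/

section Thread

variable {B : ℕ}

/-- A node holding the value `a` meets a list of tokens one after the other. A token of weight `b`
with `b + θ ≤ a` disappears, and `a` drops by `b`; otherwise `a` drops to zero and the token goes
on with weight `b - a`. The result is the final value of the node and the surviving tokens. -/
def absorb (θ : ℕ) : Fin (B + 1) → List (Option (Fin (B + 1))) →
    Fin (B + 1) × List (Fin (B + 1))
  | a, [] => (a, [])
  | a, none :: l => absorb θ a l
  | a, some b :: l =>
    if b.1 + θ ≤ a.1 then absorb θ ⟨a.1 - b.1, by omega⟩ l
    else ((absorb θ 0 l).1, ⟨b.1 - a.1, by omega⟩ :: (absorb θ 0 l).2)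

/-- The weight of a possible token. -/
def tokenWeight : Option (Fin (B + 1)) → ℤ
  | none => 0
  | some b => (b : ℕ)

/-- The number of tokens, zero or one. -/
def tokenCount : Option (Fin (B + 1)) → ℕ
  | none => 0
  | some _ => 1

theorem tokenCount_eq_zero {o : Option (Fin (B + 1))} : tokenCount o = 0 ↔ o = none := by
  cases o <;> simp [tokenCount]

theorem tokenWeight_nonneg (o : Option (Fin (B + 1))) : 0 ≤ tokenWeight o := by
  cases o <;> simp [tokenWeight]

/-- Since `θ ≤ 1`, a token that is not absorbed has `a ≤ b`, so the truncated difference `b - a` is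
exact. -/
theorem absorb_weight {θ : ℕ} (hθ : θ ≤ 1) (a : Fin (B + 1)) (l : List (Option (Fin (B + 1)))) :
    (((absorb θ a l).1 : ℕ) : ℤ) - ((absorb θ a l).2.map fun b => tokenWeight (some b)).sum =
      (a : ℕ) - (l.map tokenWeight).sum := by
  induction l generalizing a with
  | nil => simp [absorb]
  | cons o l ih =>
    cases o with
    | none => simpa [absorb, tokenWeight] using ih a
    | some b =>
      simp only [absorb]
      split_ifs with h
      · rw [ih]
        simp only [tokenWeight, List.map_cons, List.sum_cons]
        omega
      · have := ih 0
        simp only [tokenWeight, List.map_cons, List.sum_cons, Fin.val_zero] at this ⊢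
        omega

theorem absorb_le (θ : ℕ) (a : Fin (B + 1)) (l : List (Option (Fin (B + 1)))) :
    ((absorb θ a l).1 : ℕ) ≤ a := by
  induction l generalizing a with
  | nil => simp [absorb]
  | cons o l ih =>
    cases o with
    | none => simpa [absorb] using ih a
    | some b =>
      simp only [absorb]
      split_ifs with h
      · have := ih ⟨a.1 - b.1, by omega⟩
        simp only at this
        omega
      · have := ih 0
        simp only [Fin.val_zero] at this ⊢
        omega

theorem absorb_length_le_count (θ : ℕ) (a : Fin (B + 1)) (l : List (Option (Fin (B + 1)))) :
    (absorb θ a l).2.length ≤ (l.map tokenCount).sum := by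
  induction l generalizing a with
  | nil => simp [absorb]
  | cons o l ih =>
    cases o with
    | none => simpa [absorb, tokenCount] using ih a
    | some b =>
      simp only [absorb, List.map_cons, List.sum_cons, tokenCount]
      split_ifs with h
      · have := ih ⟨a.1 - b.1, by omega⟩
        omega
      · have := ih 0
        simp only [List.length_cons]
        omega

theorem absorb_length_le (θ : ℕ) (a : Fin (B + 1)) (l : List (Option (Fin (B + 1)))) :
    (absorb θ a l).2.length ≤ l.length := by
  refine (absorb_length_le_count θ a l).trans ?_
  induction l with
  | nil => simp
  | cons o l ih => cases o <;> simp [tokenCount] <;> omega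

/-- For `θ = 0` tokens keep a positive debt, because surviving means `a < b`; for `θ = 1` there is
nothing to check. A persisting token thus pushes the total below `θ`. -/
theorem absorb_valid {θ : ℕ} (a : Fin (B + 1)) (l : List (Option (Fin (B + 1))))
    (hl : ∀ b, some b ∈ l → 1 ≤ b.1 + θ) : ∀ b ∈ (absorb θ a l).2, 1 ≤ b.1 + θ := by
  induction l generalizing a with
  | nil => simp [absorb]
  | cons o l ih =>
    have ih' := fun a => ih a fun b hb => hl b (List.mem_cons_of_mem _ hb)
    cases o with
    | none => simpa [absorb] using ih' a
    | some b =>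
      simp only [absorb]
      split_ifs with h
      · exact ih' _
      · have hb := hl b (by simp)
        intro c hc
        rcases List.mem_cons.1 hc with rfl | hc
        · simp only
          omega
        · exact ih' 0 c hc

/-- A token disappears only where a value of at least `θ` stays behind. So the network never loses
both its tokens and its values of size `θ`. -/
theorem absorb_survival {θ : ℕ} (a : Fin (B + 1)) (l : List (Option (Fin (B + 1))))
    (h : θ ≤ a.1 ∨ ∃ b, some b ∈ l) : θ ≤ (absorb θ a l).1.1 ∨ (absorb θ a l).2 ≠ [] := by
  induction l generalizing a with
  | nil => simpa [absorb] using h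
  | cons o l ih =>
    cases o with
    | none => exact ih a (by simpa using h)
    | some b =>
      simp only [absorb]
      split_ifs with hb
      · refine ih _ (Or.inl ?_)
        simp only
        omega
      · simp

/-- A surviving token resets the node to zero, so a visit that changes nothing finds the value
already zero. -/
theorem absorb_eq_zero {θ : ℕ} (a : Fin (B + 1)) (l : List (Option (Fin (B + 1))))
    (ha : (absorb θ a l).1 = a) (hc : (absorb θ a l).2.length = (l.map tokenCount).sum)
    (h : ∃ b, some b ∈ l) : a = 0 := by
  induction l generalizing a with
  | nil => simp at h
  | cons o l ih =>
    cases o with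
    | none => exact ih a (by simpa [absorb] using ha) (by simpa [absorb, tokenCount] using hc)
                (by simpa using h)
    | some b =>
      simp only [absorb] at ha hc
      split_ifs at ha hc with hb
      · have := absorb_length_le_count θ ⟨a.1 - b.1, by omega⟩ l
        simp only [List.map_cons, List.sum_cons, tokenCount] at hc
        omega
      · have := absorb_le θ 0 l
        simp only at ha
        rw [ha] at this
        exact Fin.ext (by simpa using this)

/-! ### The rotor that distributes outgoing tokens. -/

/-- The elements of a list leave through the ports `r, r + 1, …` (modulo `d`). -/
def emit {α : Type*} (d r : ℕ) (L : List α) : Fin d → Option α :=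
  fun q => L[(q.1 + (d - r)) % d]?

theorem sum_getElem? {α β : Type*} [AddCommMonoid β] (f : Option α → β) (hf : f none = 0)
    (L : List α) (d : ℕ) (hL : L.length ≤ d) :
    ∑ q : Fin d, f L[q.1]? = (L.map fun b => f (some b)).sum := by
  induction L generalizing d with
  | nil => simp [hf]
  | cons b L ih =>
    obtain _ | d := d
    · simp at hL
    · rw [Fin.sum_univ_succ]
      simp only [List.length_cons] at hL
      simp [ih d (by omega)]

/-- Rotating the ports is a permutation, and at most `d` tokens leave, so none is lost or
duplicated. -/
theorem sum_emit {α β : Type*} [AddCommMonoid β] (f : Option α → β) (hf : f none = 0)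
    (L : List α) (d r : ℕ) (hL : L.length ≤ d) :
    ∑ q : Fin d, f (emit d r L q) = (L.map fun b => f (some b)).sum := by
  rw [← sum_getElem? f hf L d hL]
  let σ : Fin d → Fin d := fun q => ⟨(q.1 + (d - r)) % d, Nat.mod_lt _ q.pos⟩
  have hσ : Function.Injective σ := by
    intro p q hpq
    have h1 : p.1 + (d - r) ≡ q.1 + (d - r) [MOD d] := congrArg Fin.val hpq
    have h2 : p.1 ≡ q.1 [MOD d] := Nat.ModEq.add_right_cancel' _ h1
    exact Fin.ext (Nat.ModEq.eq_of_lt_of_lt h2 p.2 q.2)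
  exact (Equiv.ofBijective σ (Finite.injective_iff_bijective.1 hσ)).sum_comp
    (fun q => f L[q.1]?)

/-- `(q + (d - r)) % d` counts the ports that the rotor `r` uses before `q`. Sending `s` tokens
without reaching `q` shortens this distance by exactly `s`. -/
theorem rotor_distance {d q r s : ℕ} (hr : r ≤ d)
    (h : s ≤ (q + (d - r)) % d) (hd : 0 < d) :
    (q + (d - (r + s) % d)) % d = (q + (d - r)) % d - s := by
  have h3 : (q + (d - r)) % d < d := Nat.mod_lt _ hd
  have h4 : (r + s) % d < d := Nat.mod_lt _ hd
  have key : q + (d - (r + s) % d) ≡ (q + (d - r)) % d - s [MOD d] := by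
    apply Nat.ModEq.add_right_cancel' (r + s)
    calc q + (d - (r + s) % d) + (r + s)
        ≡ q + (d - (r + s) % d) + (r + s) % d [MOD d] :=
          Nat.ModEq.add_left _ (Nat.mod_modEq _ _).symm
      _ = q + (d - r) + r := by omega
      _ ≡ (q + (d - r)) % d + r [MOD d] := Nat.ModEq.add_right _ (Nat.mod_modEq _ _).symm
      _ = (q + (d - r)) % d - s + (r + s) := by omega
  have := key
  unfold Nat.ModEq at this
  rwa [Nat.mod_eq_of_lt (show (q + (d - r)) % d - s < d by omega)] at this

/-- The new state of a node and its messages when the tokens `L` leave. -/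
def release (d : ℕ) (a : Fin (B + 1)) (r : ℕ) (L : List (Fin (B + 1))) :
    (Fin (B + 1) × Fin (d + 1)) × (Fin d → Option (Fin (B + 1))) :=
  ((a, Fin.ofNat (d + 1) ((r + L.length) % d)), emit d r L)

/-- One round of a node of degree `d`. -/
def nodeStep (θ d : ℕ) (s : Fin (B + 1) × Fin (d + 1)) (inp : Fin d → Option (Fin (B + 1))) :
    (Fin (B + 1) × Fin (d + 1)) × (Fin d → Option (Fin (B + 1))) :=
  release d (absorb θ s.1 (List.ofFn inp)).1 s.2 (absorb θ s.1 (List.ofFn inp)).2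

/-- The first round of a node of degree `d`, when its weight is `w`. -/
def nodeInit (B θ d : ℕ) (w : ℤ) :
    (Fin (B + 1) × Fin (d + 1)) × (Fin d → Option (Fin (B + 1))) :=
  if w < θ then release d 0 0 [Fin.ofNat (B + 1) (-w).toNat]
  else release d (Fin.ofNat (B + 1) w.toNat) 0 []

theorem rotor_val {d : ℕ} (hd : 0 < d) (k : ℕ) : (Fin.ofNat (d + 1) (k % d) : ℕ) = k % d := by
  have := Nat.mod_lt k hd
  simp only [Fin.ofNat]
  exact Nat.mod_eq_of_lt (by omega)

theorem eventually_const_of_antitone {f : ℕ → ℕ} (hf : ∀ t, f (t + 1) ≤ f t) :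
    ∃ T, ∀ t, T ≤ t → f t = f T := by
  obtain ⟨T, hT⟩ : ∃ T, ∀ t, f T ≤ f t :=
    ⟨Function.argmin f, fun t => Function.argmin_le f t⟩
  exact ⟨T, fun t ht => le_antisymm (antitone_nat_of_succ_le hf ht) (hT t)⟩

end Thread

/-! ### The token dynamics on a network. -/

section Network

open Filter

variable {V : Type*} [Fintype V] {deg : V → ℕ} {B θ : ℕ}
  {rev : (Σ v, Fin (deg v)) ≃ Σ v, Fin (deg v)}
  {z : ℕ → ∀ v, Fin (B + 1) × Fin (deg v + 1)}
  {m : ℕ → ∀ v, Fin (deg v) → Option (Fin (B + 1))}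

/-- The tokens that arrive at `v` when the messages are `m`. -/
def incoming (rev : (Σ v, Fin (deg v)) ≃ Σ v, Fin (deg v))
    (m : ∀ v, Fin (deg v) → Option (Fin (B + 1))) (v : V) :
    Fin (deg v) → Option (Fin (B + 1)) :=
  fun k => m (rev ⟨v, k⟩).1 (rev ⟨v, k⟩).2

theorem sum_incoming {β : Type*} [AddCommMonoid β] (f : Option (Fin (B + 1)) → β)
    (m : ∀ v, Fin (deg v) → Option (Fin (B + 1))) :
    ∑ v, ∑ k, f (incoming rev m v k) = ∑ v, ∑ k, f (m v k) := by
  have := rev.sum_comp (fun e => f (m e.1 e.2))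
  rwa [Fintype.sum_sigma, Fintype.sum_sigma] at this

theorem sum_map_ofFn {α β : Type*} [AddCommMonoid β] {d : ℕ} (f : α → β) (g : Fin d → α) :
    ((List.ofFn g).map f).sum = ∑ k, f (g k) := by
  rw [List.map_ofFn, List.sum_ofFn]
  rfl

theorem sum_release {β : Type*} [AddCommMonoid β] (f : Option (Fin (B + 1)) → β)
    (hf : f none = 0) {d : ℕ} (s : Fin (B + 1) × Fin (d + 1))
    (inp : Fin d → Option (Fin (B + 1))) :
    ∑ q, f ((nodeStep θ d s inp).2 q) =
      ((absorb θ s.1 (List.ofFn inp)).2.map fun b => f (some b)).sum :=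
  sum_emit f hf _ d _ ((absorb_length_le _ _ _).trans (by simp))

theorem count_nodeStep {d : ℕ} (s : Fin (B + 1) × Fin (d + 1))
    (inp : Fin d → Option (Fin (B + 1))) :
    ∑ q, tokenCount ((nodeStep θ d s inp).2 q) =
      (absorb θ s.1 (List.ofFn inp)).2.length := by
  rw [sum_release tokenCount rfl]
  simp [tokenCount]

theorem count_nodeStep_le {d : ℕ} (s : Fin (B + 1) × Fin (d + 1))
    (inp : Fin d → Option (Fin (B + 1))) :
    ∑ q, tokenCount ((nodeStep θ d s inp).2 q) ≤ ∑ k, tokenCount (inp k) := by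
  rw [count_nodeStep, ← sum_map_ofFn tokenCount]
  exact absorb_length_le_count _ _ _

theorem weight_nodeStep (hθ : θ ≤ 1) {d : ℕ} (s : Fin (B + 1) × Fin (d + 1))
    (inp : Fin d → Option (Fin (B + 1))) :
    (((nodeStep θ d s inp).1.1 : ℕ) : ℤ) - ∑ q, tokenWeight ((nodeStep θ d s inp).2 q) =
      (s.1 : ℕ) - ∑ k, tokenWeight (inp k) := by
  rw [sum_release tokenWeight rfl, ← sum_map_ofFn tokenWeight]
  exact absorb_weight hθ _ _

theorem valid_nodeStep {d : ℕ} (s : Fin (B + 1) × Fin (d + 1))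
    (inp : Fin d → Option (Fin (B + 1))) (h : ∀ k b, inp k = some b → 1 ≤ b.1 + θ) :
    ∀ q b, (nodeStep θ d s inp).2 q = some b → 1 ≤ b.1 + θ := by
  intro q b hb
  refine absorb_valid s.1 (List.ofFn inp) ?_ b (List.mem_of_getElem? hb)
  intro c hc
  obtain ⟨k, hk⟩ := (List.mem_ofFn' _ _).1 hc
  exact h k c hk

theorem survival_nodeStep {d : ℕ} (s : Fin (B + 1) × Fin (d + 1))
    (inp : Fin d → Option (Fin (B + 1))) (h : θ ≤ s.1.1 ∨ ∃ k, inp k ≠ none) :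
    θ ≤ (nodeStep θ d s inp).1.1.1 ∨ ∃ q, (nodeStep θ d s inp).2 q ≠ none := by
  refine (absorb_survival s.1 (List.ofFn inp) (h.imp_right ?_)).imp id ?_
  · rintro ⟨k, hk⟩
    obtain ⟨b, hb⟩ := Option.ne_none_iff_exists'.1 hk
    exact ⟨b, (List.mem_ofFn' _ _).2 ⟨k, hb⟩⟩
  · intro hL
    by_contra! hq
    have := count_nodeStep (θ := θ) s inp
    simp only [hq, tokenCount, Finset.sum_const_zero] at this
    exact hL (List.length_eq_zero_iff.1 this.symm)

theorem eq_zero_of_nodeStep {d : ℕ} (s : Fin (B + 1) × Fin (d + 1))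
    (inp : Fin d → Option (Fin (B + 1))) (ha : (nodeStep θ d s inp).1.1 = s.1)
    (hc : ∑ q, tokenCount ((nodeStep θ d s inp).2 q) = ∑ k, tokenCount (inp k))
    (h : ∃ k, inp k ≠ none) : s.1 = 0 := by
  rw [count_nodeStep, ← sum_map_ofFn tokenCount] at hc
  refine absorb_eq_zero s.1 (List.ofFn inp) ha hc ?_
  obtain ⟨k, hk⟩ := h
  obtain ⟨b, hb⟩ := Option.ne_none_iff_exists'.1 hk
  exact ⟨b, (List.mem_ofFn' _ _).2 ⟨k, hb⟩⟩

/-- A node that releases tokens infinitely often uses each of its ports infinitely often. -/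
theorem frequently_port {d : ℕ} (hd : 0 < d) {s : ℕ → Fin (B + 1) × Fin (d + 1)}
    {inp out : ℕ → Fin d → Option (Fin (B + 1))}
    (hstep : ∀ t, (s (t + 1), out (t + 1)) = nodeStep θ d (s t) (inp t))
    (hfreq : ∃ᶠ t in atTop, (absorb θ (s t).1 (List.ofFn (inp t))).2 ≠ []) (q : Fin d) :
    ∃ᶠ t in atTop, out t q ≠ none := by
  intro hev
  obtain ⟨T, hT⟩ := eventually_atTop.1 hev
  -- Distance from the rotor to `q`. While `q` stays silent it drops by the number of released
  -- tokens, which cannot happen infinitely often.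
  let φ : ℕ → ℕ := fun t => (q.1 + (d - (s t).2)) % d
  let len : ℕ → ℕ := fun t => (absorb θ (s t).1 (List.ofFn (inp t))).2.length
  have hφ : ∀ t, T ≤ t → len t ≤ φ t ∧ φ (t + 1) = φ t - len t := by
    intro t ht
    have h1 : out (t + 1) q = none := by simpa using hT (t + 1) (by omega)
    rw [show out (t + 1) = (nodeStep θ d (s t) (inp t)).2 from congrArg Prod.snd (hstep t)] at h1
    have h2 : len t ≤ φ t := List.getElem?_eq_none_iff.1 h1
    have h3 : ((s (t + 1)).2 : ℕ) = ((s t).2 + len t) % d := by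
      rw [show s (t + 1) = (nodeStep θ d (s t) (inp t)).1 from congrArg Prod.fst (hstep t)]
      exact rotor_val hd _
    refine ⟨h2, ?_⟩
    simp only [φ, h3]
    exact rotor_distance (by omega) h2 hd
  obtain ⟨T', hT'⟩ := eventually_const_of_antitone (f := fun t => φ (T + t))
    (fun t => by have := hφ (T + t) (by omega); simp only [← add_assoc]; omega)
  obtain ⟨t, ht, hne⟩ := frequently_atTop.1 hfreq (T + T')
  have h1 := hT' (t - T) (by omega)
  have h2 := hT' (t + 1 - T) (by omega)
  simp only [show T + (t - T) = t by omega, show T + (t + 1 - T) = t + 1 by omega] at h1 h2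
  have h3 := hφ t (by omega)
  have : len t ≠ 0 := fun h => hne (List.length_eq_zero_iff.1 h)
  omega

/-- Starts the three invariants of `token_dichotomy`: weight, validity and survival. The bound `B`
keeps `Fin.ofNat` from wrapping around. -/
theorem nodeInit_spec (hθ : θ ≤ 1) {d : ℕ} (hd : 0 < d) {w : ℤ} (hw : |w| ≤ B) :
    (((nodeInit B θ d w).1.1 : ℕ) : ℤ) - ∑ q, tokenWeight ((nodeInit B θ d w).2 q) = w ∧
    (∀ q b, (nodeInit B θ d w).2 q = some b → 1 ≤ b.1 + θ) ∧
    (θ ≤ (nodeInit B θ d w).1.1.1 ∨ ∃ q, (nodeInit B θ d w).2 q ≠ none) := by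
  have hw' := abs_le.1 hw
  unfold nodeInit
  split_ifs with h
  · have hb : (Fin.ofNat (B + 1) (-w).toNat : ℕ) = (-w).toNat :=
      Nat.mod_eq_of_lt (by omega)
    have hsum : ∀ {β : Type} [AddCommMonoid β] (f : Option (Fin (B + 1)) → β), f none = 0 →
        ∑ q, f (emit d 0 [Fin.ofNat (B + 1) (-w).toNat] q) =
          f (some (Fin.ofNat (B + 1) (-w).toNat)) := by
      intro β _ f hf
      rw [sum_emit f hf _ _ _ (by simpa using Nat.succ_le_of_lt hd)]
      simp
    refine ⟨?_, ?_, Or.inr ?_⟩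
    · simp only [release]
      rw [hsum tokenWeight rfl]
      simp only [tokenWeight, hb, Fin.val_zero]
      omega
    · intro q b hq
      have := List.mem_of_getElem? hq
      rw [List.mem_singleton.1 this, hb]
      omega
    · by_contra! hq
      have := hsum tokenCount rfl
      have h0 := this.symm.trans
        (Finset.sum_eq_zero fun q _ => tokenCount_eq_zero.2 (hq q))
      exact absurd h0 (by simp [tokenCount])
  · have ha : (Fin.ofNat (B + 1) w.toNat : ℕ) = w.toNat := Nat.mod_eq_of_lt (by omega)
    refine ⟨?_, ?_, Or.inl ?_⟩
    · simp only [release]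
      rw [sum_emit tokenWeight rfl _ _ _ (by simp)]
      simp only [ha, List.map_nil, List.sum_nil]
      omega
    · simp [release, emit]
    · simp only [release, ha]
      omega

/-- The dichotomy for the token dynamics: if the sum of the weights reaches the threshold `θ`, all
tokens disappear; otherwise every node is visited by tokens infinitely often. -/
theorem token_dichotomy [Nonempty V] (hθ : θ ≤ 1) (hdeg : ∀ v, 0 < deg v)
    (hconn : ∀ v w, Relation.ReflTransGen (fun v w => ∃ k, (rev ⟨w, k⟩).1 = v) v w)
    {w : V → ℤ} (hw : ∀ v, |w v| ≤ B)
    (hinit : ∀ v, (z 0 v, m 0 v) = nodeInit B θ (deg v) (w v))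
    (hstep : ∀ t v, (z (t + 1) v, m (t + 1) v) =
      nodeStep θ (deg v) (z t v) (incoming rev (m t) v)) :
    (θ ≤ ∑ v, w v → ∀ᶠ t in atTop, ∀ v k, incoming rev (m t) v k = none) ∧
    (∑ v, w v < θ → ∀ v, ∃ᶠ t in atTop, ∃ k, incoming rev (m t) v k ≠ none) := by
  have hz0 : ∀ v, z 0 v = (nodeInit B θ (deg v) (w v)).1 := fun v => congrArg Prod.fst (hinit v)
  have hm0 : ∀ v, m 0 v = (nodeInit B θ (deg v) (w v)).2 := fun v => congrArg Prod.snd (hinit v)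
  have hz : ∀ t v, z (t + 1) v = (nodeStep θ (deg v) (z t v) (incoming rev (m t) v)).1 :=
    fun t v => congrArg Prod.fst (hstep t v)
  have hm : ∀ t v, m (t + 1) v = (nodeStep θ (deg v) (z t v) (incoming rev (m t) v)).2 :=
    fun t v => congrArg Prod.snd (hstep t v)
  have hspec := fun v => nodeInit_spec (B := B) hθ (hdeg v) (hw v)
  have hsum : ∀ t, (∑ v, (((z t v).1 : ℕ) : ℤ)) - ∑ v, ∑ q, tokenWeight (m t v q) =
      ∑ v, w v := by
    intro t
    induction t with
    | zero =>
      rw [← Finset.sum_sub_distrib]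
      refine Finset.sum_congr rfl fun v _ => ?_
      rw [hz0, hm0]
      exact (hspec v).1
    | succ t ih =>
      rw [← ih, ← sum_incoming (rev := rev) tokenWeight (m t), ← Finset.sum_sub_distrib,
        ← Finset.sum_sub_distrib]
      refine Finset.sum_congr rfl fun v _ => ?_
      rw [hz, hm]
      exact weight_nodeStep hθ _ _
  have hvalid : ∀ t v q b, m t v q = some b → 1 ≤ b.1 + θ := by
    intro t
    induction t with
    | zero =>
      intro v q b hb
      rw [hm0] at hb
      exact (hspec v).2.1 q b hb
    | succ t ih =>
      intro v q b hb
      rw [hm] at hb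
      exact valid_nodeStep _ _ (fun k b hk => ih _ _ b hk) q b hb
  have hsurv : ∀ t, (∃ v, θ ≤ (z t v).1.1) ∨ ∃ v q, m t v q ≠ none := by
    intro t
    induction t with
    | zero =>
      obtain ⟨v⟩ := ‹Nonempty V›
      rcases (hspec v).2.2 with h | h
      · exact Or.inl ⟨v, by rwa [hz0]⟩
      · exact Or.inr ⟨v, by rwa [hm0]⟩
    | succ t ih =>
      obtain ⟨v, hv⟩ : ∃ v, θ ≤ (z t v).1.1 ∨ ∃ k, incoming rev (m t) v k ≠ none := by
        rcases ih with ⟨v, hv⟩ | ⟨v, q, hq⟩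
        · exact ⟨v, Or.inl hv⟩
        · obtain ⟨e, he⟩ := rev.surjective ⟨v, q⟩
          refine ⟨e.1, Or.inr ⟨e.2, ?_⟩⟩
          simp only [incoming]
          rwa [he]
      rcases survival_nodeStep _ _ hv with h | h
      · exact Or.inl ⟨v, by rwa [hz]⟩
      · exact Or.inr ⟨v, by rwa [hm]⟩
  let N : ℕ → ℕ := fun t => ∑ v, ∑ q, tokenCount (m t v q)
  let S : ℕ → ℕ := fun t => ∑ v, (z t v).1.1
  have hNle : ∀ t v, ∑ q, tokenCount (m (t + 1) v q) ≤
      ∑ k, tokenCount (incoming rev (m t) v k) := by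
    intro t v
    rw [hm]
    exact count_nodeStep_le _ _
  have hSle : ∀ t v, (z (t + 1) v).1.1 ≤ (z t v).1.1 := by
    intro t v
    rw [hz]
    exact absorb_le _ _ _
  have hNanti : ∀ t, N (t + 1) ≤ N t := fun t => by
    refine (Finset.sum_le_sum fun v _ => hNle t v).trans ?_
    exact (sum_incoming tokenCount (m t)).le
  obtain ⟨T₁, hT₁⟩ := eventually_const_of_antitone hNanti
  obtain ⟨T₂, hT₂⟩ := eventually_const_of_antitone (f := S)
    fun t => Finset.sum_le_sum fun v _ => hSle t v
  by_cases hN : N T₁ = 0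
  · have hnone : ∀ t, T₁ ≤ t → ∀ v q, m t v q = none := by
      intro t ht v q
      have h1 : N t = 0 := (hT₁ t ht).trans hN
      have h2 := (Finset.sum_eq_zero_iff.1 h1) v (Finset.mem_univ v)
      exact tokenCount_eq_zero.1 ((Finset.sum_eq_zero_iff.1 h2) q (Finset.mem_univ q))
    have hle : (θ : ℤ) ≤ ∑ v, w v := by
      obtain ⟨v, hv⟩ | ⟨v, q, hq⟩ := hsurv T₁
      · rw [← hsum T₁]
        have h1 : ∑ v, ∑ q, tokenWeight (m T₁ v q) = 0 :=
          Finset.sum_eq_zero fun v _ => Finset.sum_eq_zero fun q _ => by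
            rw [hnone T₁ le_rfl]
            rfl
        have h2 : (((z T₁ v).1 : ℕ) : ℤ) ≤ ∑ v, (((z T₁ v).1 : ℕ) : ℤ) :=
          Finset.single_le_sum (f := fun v => (((z T₁ v).1 : ℕ) : ℤ))
            (fun _ _ => Int.natCast_nonneg _) (Finset.mem_univ v)
        omega
      · exact absurd (hnone T₁ le_rfl v q) hq
    refine ⟨fun _ => ?_, fun h => absurd h (not_lt.2 hle)⟩
    exact eventually_atTop.2 ⟨T₁, fun t ht v k => hnone t ht _ _⟩
  · have hNpos : ∀ t, T₁ ≤ t → 0 < N t := fun t ht => by rw [hT₁ t ht]; omega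
    have hcount : ∀ t, T₁ ≤ t → ∀ v, ∑ q, tokenCount (m (t + 1) v q) =
        ∑ k, tokenCount (incoming rev (m t) v k) := by
      intro t ht v
      -- Equal sums with termwise inequalities: a constant total means that no node destroys a token
      -- any more.
      refine (Finset.sum_eq_sum_iff_of_le fun v _ => hNle t v).1 ?_ v (Finset.mem_univ v)
      rw [sum_incoming tokenCount (m t)]
      exact (hT₁ (t + 1) (by omega)).trans (hT₁ t ht).symm
    have hconst : ∀ t, T₂ ≤ t → ∀ v, (z (t + 1) v).1 = (z t v).1 := by
      intro t ht v
      refine Fin.ext ((Finset.sum_eq_sum_iff_of_le fun v _ => hSle t v).1 ?_ v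
        (Finset.mem_univ v))
      exact (hT₂ (t + 1) (by omega)).trans (hT₂ t ht).symm
    have hvisit : ∃ v, ∃ᶠ t in atTop, ∃ k, incoming rev (m t) v k ≠ none := by
      by_contra h
      simp only [not_exists, not_frequently] at h
      obtain ⟨t, ht, h1⟩ := ((eventually_ge_atTop T₁).and (eventually_all.2 h)).exists
      have h2 := hNpos t ht
      simp only [N] at h2
      rw [← sum_incoming (rev := rev) tokenCount (m t)] at h2
      refine h2.ne' (Finset.sum_eq_zero fun v _ => Finset.sum_eq_zero fun k _ => ?_)
      exact tokenCount_eq_zero.2 (not_ne_iff.1 (h1 v k))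
    -- Past `T₁` every arriving token leaves again, so a node visited infinitely often releases
    -- tokens infinitely often, and its rotor serves each neighbor.
    have hprop : ∀ v w, (∃ k, (rev ⟨w, k⟩).1 = v) →
        (∃ᶠ t in atTop, ∃ k, incoming rev (m t) v k ≠ none) →
        ∃ᶠ t in atTop, ∃ k, incoming rev (m t) w k ≠ none := by
      rintro v w ⟨k, rfl⟩ hv
      have h1 := frequently_port (hdeg _) (s := fun t => z t (rev ⟨w, k⟩).1)
        (out := fun t => m t (rev ⟨w, k⟩).1) (fun t => hstep t (rev ⟨w, k⟩).1)
        ((hv.and_eventually (eventually_ge_atTop T₁)).mono ?_) (rev ⟨w, k⟩).2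
      · exact h1.mono fun t ht => ⟨k, ht⟩
      · rintro t ⟨⟨k', hk'⟩, ht⟩ hnil
        have h2 := hcount t ht (rev ⟨w, k⟩).1
        rw [hm, count_nodeStep, hnil, List.length_nil] at h2
        exact hk' (tokenCount_eq_zero.1
          (Finset.sum_eq_zero_iff.1 h2.symm k' (Finset.mem_univ k')))
    have hall : ∀ v, ∃ᶠ t in atTop, ∃ k, incoming rev (m t) v k ≠ none := by
      obtain ⟨v₀, hv₀⟩ := hvisit
      intro v
      induction hconn v₀ v with
      | refl => exact hv₀
      | tail _ h ih => exact hprop _ _ h ih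
    have hlt : ∑ v, w v < (θ : ℤ) := by
      obtain ⟨T, hT⟩ : ∃ T, T = max T₁ T₂ := ⟨_, rfl⟩
      -- A later visit changes neither the value nor the token count, so it finds the value zero;
      -- the value has been constant since `T`.
      have hzero : ∀ v, (z T v).1 = 0 := by
        intro v
        obtain ⟨t, ht, hk⟩ := frequently_atTop.1 (hall v) T
        have h1 : (z t v).1 = 0 := by
          refine eq_zero_of_nodeStep (θ := θ) _ _ ?_ ?_ hk
          · rw [← hz]
            exact hconst t (by omega) v
          · rw [← hm]
            exact hcount t (by omega) v
        have h2 : ∀ t, T ≤ t → (z t v).1 = (z T v).1 := by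
          intro t ht
          induction t, ht using Nat.le_induction with
          | base => rfl
          | succ t ht ih => exact (hconst t (by omega) v).trans ih
        exact (h2 t ht).symm.trans h1
      obtain ⟨v, q, hq⟩ : ∃ v q, m T v q ≠ none := by
        by_contra! h
        refine (hNpos T (by omega)).ne' ?_
        exact Finset.sum_eq_zero fun v _ => Finset.sum_eq_zero fun q _ =>
          tokenCount_eq_zero.2 (h v q)
      obtain ⟨b, hb⟩ := Option.ne_none_iff_exists'.1 hq
      have h1 := hvalid T v q b hb
      have h2 : tokenWeight (m T v q) ≤ ∑ q, tokenWeight (m T v q) :=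
        Finset.single_le_sum (f := fun q => tokenWeight (m T v q))
          (fun _ _ => tokenWeight_nonneg _) (Finset.mem_univ q)
      have h3 : ∑ q, tokenWeight (m T v q) ≤ ∑ v, ∑ q, tokenWeight (m T v q) :=
        Finset.single_le_sum (f := fun v => ∑ q, tokenWeight (m T v q))
          (fun _ _ => Finset.sum_nonneg fun _ _ => tokenWeight_nonneg _) (Finset.mem_univ v)
      have h4 : ∑ v, (((z T v).1 : ℕ) : ℤ) = 0 :=
        Finset.sum_eq_zero fun v _ => by rw [hzero v]; rfl
      have h5 : tokenWeight (m T v q) = (b : ℕ) := by rw [hb]; rfl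
      have h6 := hsum T
      omega
    exact ⟨fun h => absurd h (not_le.2 hlt), fun _ => hall⟩

end Network

/-! ### The automaton that runs both tests for every sum. -/

section Automaton

open Filter

variable {K : ℕ} {Y ι : Type*}

/-- The weights used by the two token dynamics that test the sign of a sum of weights. -/
def signWeight (W : ι → Fin K → ℤ) (c : ι × Bool) (x : Fin K) : ℤ :=
  if c.2 then W c.1 x else -W c.1 x

/-- The thresholds of the two token dynamics that test the sign of a sum of weights. -/
def signThreshold (c : ι × Bool) : ℕ := if c.2 then 1 else 0

/-- The memory of a node of degree `d`: once initialized, a value and a rotor for each token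
dynamics, and for each sum of weights the presumed answer whether it is at most zero. -/
abbrev SignMemory (ι : Type*) (B d : ℕ) : Type _ :=
  Option ((ι × Bool → Fin (B + 1) × Fin (d + 1)) × (ι → Bool))

/-- The messages: possibly a token for each of the token dynamics. -/
abbrev SignMessage (ι : Type*) (B : ℕ) : Type _ := ι × Bool → Option (Fin (B + 1))

/-- The answers are updated according to the dynamics whose tokens arrive. -/
noncomputable def updateAnswer {B d : ℕ} (g : ι → Bool) (inp : Fin d → SignMessage ι B)
    (c : ι) : Bool :=
  open Classical in
  -- The priority between the two kinds is immaterial: eventually only one of them has tokens.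
  if ∃ k, inp k (c, true) ≠ none then true
  else if ∃ k, inp k (c, false) ≠ none then false else g c

/-- The transition map of the automaton that finds the signs of sums of weights. -/
noncomputable def signStep (W : ι → Fin K → ℤ) (B : ℕ) (out : (ι → Bool) → Y) (d : ℕ)
    (x : Fin K) (z : SignMemory ι B d) (y : Y) (inp : Fin d → SignMessage ι B) :
    SignMemory ι B d × Y × (Fin d → SignMessage ι B) :=
  if d = 0 then (z, out fun c => decide (W c x ≤ 0), inp)
  else match z with
  | none =>
    (some (fun c => (nodeInit B (signThreshold c) d (signWeight W c x)).1, fun _ => true), y,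
      fun q c => (nodeInit B (signThreshold c) d (signWeight W c x)).2 q)
  | some (s, g) =>
    (some (fun c => (nodeStep (signThreshold c) d (s c) (fun k => inp k c)).1,
        updateAnswer g inp),
      out (updateAnswer g inp),
      fun q c => (nodeStep (signThreshold c) d (s c) (fun k => inp k c)).2 q)

/-- The number of states is polynomial in `d`, through the rotors; `d + 1 ≤ 2 ^ d` gives an
exponential bound. -/
theorem exists_log_card_signMemory_le (ι : Type*) [Finite ι] (B : ℕ) :
    ∃ C : ℝ, ∀ d : ℕ, 1 ≤ d → Real.log (Nat.card (SignMemory ι B d)) ≤ C * d := by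
  have := Fintype.ofFinite ι
  classical
  let k := Fintype.card (ι × Bool)
  let P := ((B + 1) * 2) ^ k
  let Q := 2 ^ Fintype.card ι
  refine ⟨Real.log (P * Q + 1 : ℕ), fun d hd => ?_⟩
  have hcard : Nat.card (SignMemory ι B d) = ((B + 1) * (d + 1)) ^ k * Q + 1 := by
    simp [SignMemory, Nat.card_eq_fintype_card, k, Q]
  have h1 : (B + 1) * (d + 1) ≤ ((B + 1) * 2) ^ d := by
    rw [mul_pow]
    exact Nat.mul_le_mul (Nat.le_self_pow (by omega) _) Nat.lt_two_pow_self
  have h2 : ((B + 1) * (d + 1)) ^ k ≤ P ^ d := by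
    refine (Nat.pow_le_pow_left h1 k).trans (le_of_eq ?_)
    simp only [P]
    rw [← pow_mul, ← pow_mul, mul_comm d k]
  have h3 : ((B + 1) * (d + 1)) ^ k * Q + 1 ≤ (P * Q + 1) ^ d := by
    calc ((B + 1) * (d + 1)) ^ k * Q + 1 ≤ P ^ d * Q ^ d + 1 ^ d := by
          rw [one_pow]
          exact Nat.add_le_add_right (Nat.mul_le_mul h2 (Nat.le_self_pow (by omega) _)) 1
      _ = (P * Q) ^ d + 1 ^ d := by rw [mul_pow]
      _ ≤ (P * Q + 1) ^ d := pow_add_pow_le (Nat.zero_le _) (Nat.zero_le _) (by omega)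
  rw [hcard]
  calc Real.log ((((B + 1) * (d + 1)) ^ k * Q + 1 : ℕ) : ℝ)
      ≤ Real.log (((P * Q + 1) ^ d : ℕ) : ℝ) :=
        Real.log_le_log (by positivity) (by exact_mod_cast h3)
    _ = Real.log (P * Q + 1 : ℕ) * d := by
        rw [Nat.cast_pow, Real.log_pow, mul_comm]

/-- The automaton that finds the signs of sums of weights and applies `out` to the answers. -/
noncomputable def signAutomaton {ι : Type} [Finite ι] (W : ι → Fin K → ℤ) (B : ℕ)
    (out : (ι → Bool) → Y) : AutomatonFamily (Fin K) Y where
  Z := SignMemory ι B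
  M := SignMessage ι B
  finite_Z _ := inferInstance
  finite_M := inferInstance
  z0 _ := none
  m0 _ := none
  step := signStep W B out
  memory_bound := exists_log_card_signMemory_le ι B

/-- The ports of a network, each sent to the port at the other end of its edge. -/
def portReversal {V : Type*} {G : SimpleGraph V} [G.LocallyFinite] (port : PortLabeling G) :
    (Σ v, Fin (G.degree v)) ≃ Σ v, Fin (G.degree v) :=
  Function.Involutive.toPerm
    (fun e => ⟨port e.1 e.2, (port (port e.1 e.2)).symm ⟨e.1, (port e.1 e.2).2.symm⟩⟩) <| by
    rintro ⟨v, k⟩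
    -- The far end is generalized to `u` with `u = v`, so that substitution takes care of the
    -- dependent types.
    have key : ∀ (w : V) (hw : G.Adj v w) (u : G.neighborSet w) (hu : (u : V) = v)
        (ha : G.Adj u w),
        (⟨u, (port u).symm ⟨w, ha⟩⟩ : Σ v, Fin (G.degree v)) = ⟨v, (port v).symm ⟨w, hw⟩⟩ := by
      rintro w hw ⟨u, hu'⟩ rfl ha
      rfl
    refine (key (port v k) (port v k).2 _ (by simp) _).trans ?_
    simp

theorem reflTransGen_portReversal {V : Type*} {G : SimpleGraph V} [G.LocallyFinite]
    (hG : G.Connected) (port : PortLabeling G) (v w : V) :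
    Relation.ReflTransGen (fun v w => ∃ k, (portReversal port ⟨w, k⟩).1 = v) v w := by
  obtain ⟨p⟩ := hG.preconnected v w
  induction p with
  | nil => exact .refl
  | @cons u v' w h p ih =>
    refine .head ⟨(port v').symm ⟨u, h.symm⟩, ?_⟩ ih
    exact congrArg Subtype.val ((port v').apply_symm_apply ⟨u, h.symm⟩)

variable {ι : Type} [Finite ι] {W : ι → Fin K → ℤ} {B : ℕ} {out : (ι → Bool) → Y} {y0 : Y}

theorem signAutomaton_isFinalOutput_of_degree_pos {V : Type*} [Fintype V] [Nonempty V]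
    (hB : ∀ c k, |W c k| ≤ B) (G : SimpleGraph V) [G.LocallyFinite] (hG : G.Connected)
    (hdeg : ∀ v, 0 < G.degree v) (port : PortLabeling G) (x : V → Fin K) :
    (signAutomaton W B out).IsFinalOutput y0 G port x
      (out fun c => decide (∑ v, W c (x v) ≤ 0)) := by
  let R := (signAutomaton W B out).run y0 G port x
  let msg : ℕ → ∀ v, Fin (G.degree v) → SignMessage ι B := fun t v => (R t v).2.2
  let inp : ℕ → ∀ v, Fin (G.degree v) → SignMessage ι B := fun t v k =>
    msg t (portReversal port ⟨v, k⟩).1 (portReversal port ⟨v, k⟩).2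
  have hR : ∀ t v, R (t + 1) v =
      signStep W B out (G.degree v) (x v) (R t v).1 (R t v).2.1 (inp t v) := fun t v => rfl
  have hR1 : ∀ v, R 1 v = (some (fun c => (nodeInit B (signThreshold c) (G.degree v)
      (signWeight W c (x v))).1, fun _ => true), y0,
      fun q c => (nodeInit B (signThreshold c) (G.degree v) (signWeight W c (x v))).2 q) := by
    intro v
    rw [hR 0 v]
    have h0 : (R 0 v).1 = none := rfl
    rw [h0]
    simp only [signStep, if_neg (hdeg v).ne']
    rfl
  have hR2 : ∀ t v s g, (R t v).1 = some (s, g) →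
      R (t + 1) v = (some (fun c => (nodeStep (signThreshold c) (G.degree v) (s c)
        (fun k => inp t v k c)).1, updateAnswer g (inp t v)), out (updateAnswer g (inp t v)),
        fun q c => (nodeStep (signThreshold c) (G.degree v) (s c) (fun k => inp t v k c)).2 q) := by
    intro t v s g h
    rw [hR, h]
    simp only [signStep, if_neg (hdeg v).ne']
    rfl
  have hsome : ∀ t v, ∃ sg, (R (t + 1) v).1 = some sg := by
    intro t v
    induction t with
    | zero => exact ⟨_, congrArg Prod.fst (hR1 v)⟩
    | succ t ih =>
      obtain ⟨⟨s, g⟩, h⟩ := ih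
      exact ⟨_, congrArg Prod.fst (hR2 _ _ _ _ h)⟩
  choose sg hsg using hsome
  have hstep := fun t v => hR2 (t + 1) v (sg t v).1 (sg t v).2 (hsg t v)
  have hanswer : ∀ t v, (sg (t + 1) v).2 = updateAnswer (sg t v).2 (inp (t + 1) v) := by
    intro t v
    have h := congrArg Prod.fst (hstep t v)
    rw [hsg] at h
    exact congrArg Prod.snd (Option.some.inj h)
  have hout : ∀ t v, (R (t + 2) v).2.1 = out (sg (t + 1) v).2 := by
    intro t v
    rw [hanswer, hstep]
  -- Round one only initializes, so time `t` of the token dynamics is time `t + 1` of the automaton.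
  have hdich := fun c : ι × Bool =>
    token_dichotomy (rev := portReversal port) (θ := signThreshold c)
      (z := fun t v => (sg t v).1 c) (m := fun t v q => msg (t + 1) v q c)
      (w := fun v => signWeight W c (x v)) (B := B)
      (by unfold signThreshold; split_ifs <;> simp) hdeg (reflTransGen_portReversal hG port)
      (by
        intro v
        unfold signWeight
        split_ifs
        · exact hB _ _
        · rw [abs_neg]
          exact hB _ _)
      (by
        intro v
        have h1 := hsg 0 v
        have h2 : msg 1 v = _ := congrArg (fun r => r.2.2) (hR1 v)
        rw [hR1] at h1
        simp only [zero_add, ← Option.some.inj h1, h2])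
      (by
        intro t v
        have h1 := hsg (t + 1) v
        have h2 : msg (t + 2) v = _ := congrArg (fun r => r.2.2) (hstep t v)
        rw [hstep] at h1
        simp only [← Option.some.inj h1, h2]
        rfl)
  have hstable : ∀ c, ∀ᶠ t in atTop, ∀ v,
      (sg t v).2 c = decide (∑ v, W c (x v) ≤ 0) := by
    intro c
    have hup : ∀ t v, (sg (t + 1) v).2 c = updateAnswer (sg t v).2 (inp (t + 1) v) c :=
      fun t v => congrFun (hanswer t v) c
    -- Once the tokens of kind `!b` are gone, the first visit of kind `b` sets the answer and
    -- nothing reverses it.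
    have settle : ∀ b : Bool,
        (∀ᶠ t in atTop, ∀ v k, inp (t + 1) v k (c, !b) = none) →
        (∀ v, ∃ᶠ t in atTop, ∃ k, inp (t + 1) v k (c, b) ≠ none) →
        ∀ᶠ t in atTop, ∀ v, (sg t v).2 c = b := by
      intro b hquiet hbusy
      obtain ⟨T, hT⟩ := eventually_atTop.1 hquiet
      refine eventually_all.2 fun v => ?_
      obtain ⟨T', hT', hk⟩ := frequently_atTop.1 (hbusy v) T
      refine eventually_atTop.2 ⟨T' + 1, fun t ht => ?_⟩
      induction t, ht using Nat.le_induction with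
      | base =>
        rw [hup]
        have := hT T' hT' v
        cases b <;> simp_all [updateAnswer]
      | succ t ht ih =>
        rw [hup]
        have := hT t (by omega) v
        cases b <;> simp_all [updateAnswer]
    have ht := hdich (c, true)
    have hf := hdich (c, false)
    simp only [signThreshold, signWeight, if_true, Bool.false_eq_true, if_false, Nat.cast_one,
      Nat.cast_zero, Finset.sum_neg_distrib] at ht hf
    by_cases h : ∑ v, W c (x v) ≤ 0
    · rw [decide_eq_true h]
      exact settle true (hf.1 (by omega)) (ht.2 (by omega))
    · rw [decide_eq_false h]
      exact settle false (ht.1 (by omega)) (hf.2 (by omega))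
  obtain ⟨T, hT⟩ := eventually_atTop.1 (eventually_all.2 hstable)
  refine ⟨T + 2, fun t ht v => ?_⟩
  obtain ⟨t, rfl⟩ : ∃ s, t = s + 2 := ⟨t - 2, by omega⟩
  refine (hout t v).trans ?_
  congr 1
  funext c
  exact hT (t + 1) (by omega) c v

/-- On one node the degree is zero and the sum is the node's own weight, which the automaton tests
directly. -/
theorem signAutomaton_isFinalOutput {n : ℕ} (hB : ∀ c k, |W c k| ≤ B)
    (G : SimpleGraph (Fin n)) [G.LocallyFinite] (hG : G.Connected) (port : PortLabeling G)
    (x : Fin n → Fin K) :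
    (signAutomaton W B out).IsFinalOutput y0 G port x
      (out fun c => decide (∑ i, W c (x i) ≤ 0)) := by
  have := hG.nonempty
  rcases subsingleton_or_nontrivial (Fin n) with hn | hn
  · refine ⟨1, fun t ht i => ?_⟩
    obtain ⟨t, rfl⟩ : ∃ s, t = s + 1 := ⟨t - 1, by omega⟩
    have hd : G.degree i = 0 := by
      rw [← SimpleGraph.card_neighborFinset_eq_degree, Finset.card_eq_zero]
      ext j
      simp [Subsingleton.elim j i]
    have hsum : ∀ c, ∑ j, W c (x j) = W c (x i) := fun c =>
      Fintype.sum_subsingleton _ i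
    simp only [hsum]
    change (signStep W B out (G.degree i) (x i) _ _ _).2.1 = _
    simp only [signStep, if_pos hd]
  · exact signAutomaton_isFinalOutput_of_degree_pos hB G hG
      (fun v => hG.preconnected.degree_pos_of_nontrivial v) port x

end Automaton

/-! ### From rational inequalities to integer weights. -/

section Inequalities

variable {K : ℕ}

/-- Integer weights whose sum tests a linear inequality for the frequencies: the weights are
negated for strict inequalities, and then the sum must be positive. -/
theorem RatLinIneq.exists_weight (c : RatLinIneq K) :
    ∃ w : Fin K → ℤ, ∀ (n : ℕ) (hn : 0 < n) (x : Fin n → Fin K),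
      (⟨freq x, freq_mem hn x⟩ : stdSimplex ℝ (Fin K)) ∈ c.solutions ↔
        Xor (c.strict = true) (∑ i, w (x i) ≤ 0) := by
  -- A common denominator of the bound and all coefficients.
  let D : ℕ := c.bound.den * ∏ k, (c.coeff k).den
  have hD : 0 < D := Nat.mul_pos c.bound.den_pos (Finset.prod_pos fun k _ => (c.coeff k).den_pos)
  have hint : ∀ q : ℚ, q.den ∣ D → ∃ z : ℤ, (z : ℝ) = D * (q : ℝ) := by
    rintro q ⟨e, he⟩
    refine ⟨q.num * e, ?_⟩
    have h1 : (q : ℝ) * q.den = q.num := by exact_mod_cast Rat.mul_den_eq_num q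
    rw [he]
    push_cast
    rw [← h1]
    ring
  obtain ⟨β, hβ⟩ := hint c.bound (Dvd.intro _ rfl)
  choose α hα using fun k => hint (c.coeff k)
    ((Finset.dvd_prod_of_mem (fun k => (c.coeff k).den) (Finset.mem_univ k)).mul_left _)
  -- Charging `β` to every node scales the bound by `n`, so the weights need not depend on `n`.
  have key : ∀ (n : ℕ) (hn : 0 < n) (x : Fin n → Fin K),
      ((∑ i, (α (x i) - β) : ℤ) : ℝ) =
        (D * n : ℝ) * (∑ k, (c.coeff k : ℝ) * freq x k - c.bound) := by
    intro n hn x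
    have hn' : (n : ℝ) ≠ 0 := by positivity
    have h1 : ∑ i, (α (x i) : ℝ) = ∑ k, (n * freq x k) * α k := by
      rw [← Finset.sum_fiberwise (s := Finset.univ) (g := x)]
      refine Finset.sum_congr rfl fun k _ => ?_
      rw [Finset.sum_congr rfl (g := fun _ => (α k : ℝ))
        (fun i hi => by rw [(Finset.mem_filter.1 hi).2])]
      rw [Finset.sum_const, nsmul_eq_mul]
      unfold freq
      rw [mul_div_cancel₀ _ hn']
    push_cast
    rw [Finset.sum_sub_distrib, h1, Finset.sum_const, Finset.card_univ, Fintype.card_fin,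
      nsmul_eq_mul, hβ, mul_sub, Finset.mul_sum]
    congr 1
    · refine Finset.sum_congr rfl fun k _ => ?_
      rw [hα]
      ring
    · ring
  have hle : ∀ (n : ℕ) (hn : 0 < n) (x : Fin n → Fin K),
      (∑ i, (α (x i) - β) ≤ 0 ↔ ∑ k, (c.coeff k : ℝ) * freq x k ≤ c.bound) ∧
      (0 ≤ ∑ i, (α (x i) - β) ↔ (c.bound : ℝ) ≤ ∑ k, (c.coeff k : ℝ) * freq x k) := by
    intro n hn x
    have hpos : (0 : ℝ) < D * n := by positivity
    rw [← Int.cast_nonpos (R := ℝ), ← Int.cast_nonneg_iff (R := ℝ), key n hn x]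
    exact ⟨by rw [← not_lt, mul_pos_iff_of_pos_left hpos, not_lt, sub_nonpos],
      by rw [mul_nonneg_iff_of_pos_left hpos, sub_nonneg]⟩
  by_cases hs : c.strict = true
  · refine ⟨fun k => -(α k - β), fun n hn x => ?_⟩
    simp only [RatLinIneq.solutions, hs, if_true, Set.mem_ofPred_eq, Finset.sum_neg_distrib,
      Left.neg_nonpos_iff, (hle n hn x).2]
    simp only [Xor, not_true, true_and, and_false, or_false, not_le]
    exact Iff.rfl
  · refine ⟨fun k => α k - β, fun n hn x => ?_⟩
    simp only [RatLinIneq.solutions, hs, Set.mem_ofPred_eq, (hle n hn x).1]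
    simp only [Xor, Bool.false_eq_true, if_false, not_false_eq_true, false_and, and_true, false_or]
    exact Iff.rfl

/-- A function with polyhedral level sets depends only on the signs of finitely many sums of
integer weights. -/
theorem exists_weights_of_isRatPolyhedral {Y : Type*} [Finite Y] (h : stdSimplex ℝ (Fin K) → Y)
    (hlevel : ∀ y : Y, IsRatPolyhedral {p | h p = y}) :
    ∃ (ι : Type) (_ : Finite ι) (W : ι → Fin K → ℤ),
      ∀ (n n' : ℕ) (hn : 0 < n) (hn' : 0 < n') (x : Fin n → Fin K) (x' : Fin n' → Fin K),
        (∀ c, ∑ i, W c (x i) ≤ 0 ↔ ∑ i, W c (x' i) ≤ 0) →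
        h ⟨freq x, freq_mem hn x⟩ = h ⟨freq x', freq_mem hn' x'⟩ := by
  choose m r c hc using hlevel
  -- All inequalities of all level sets: inputs agreeing on `F` lie in the same pieces.
  let F : Set (RatLinIneq K) := ⋃ (y : Y) (i : Fin (m y)), Set.range (c y i)
  have hF : F.Finite := Set.finite_iUnion fun y => Set.finite_iUnion fun i => Set.finite_range _
  choose w hw using fun c : RatLinIneq K => c.exists_weight
  refine ⟨F, hF.to_subtype, fun c => w c, fun n n' hn hn' x x' hxx' => ?_⟩
  have hiff : ∀ c ∈ F, (⟨freq x, freq_mem hn x⟩ : stdSimplex ℝ (Fin K)) ∈ c.solutions ↔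
      (⟨freq x', freq_mem hn' x'⟩ : stdSimplex ℝ (Fin K)) ∈ c.solutions := by
    intro c hcF
    rw [hw c n hn x, hw c n' hn' x', hxx' ⟨c, hcF⟩]
  have hmem : (⟨freq x, freq_mem hn x⟩ : stdSimplex ℝ (Fin K)) ∈
      {p | h p = h ⟨freq x, freq_mem hn x⟩} := rfl
  rw [hc] at hmem
  obtain ⟨i, hi⟩ := Set.mem_iUnion.1 hmem
  have hmem' : (⟨freq x', freq_mem hn' x'⟩ : stdSimplex ℝ (Fin K)) ∈
      {p | h p = h ⟨freq x, freq_mem hn x⟩} := by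
    rw [hc]
    refine Set.mem_iUnion.2 ⟨i, Set.mem_iInter.2 fun j => ?_⟩
    refine (hiff _ ?_).1 (Set.mem_iInter.1 hi j)
    exact Set.mem_iUnion.2 ⟨_, Set.mem_iUnion.2 ⟨i, Set.mem_range_self j⟩⟩
  exact hmem'.symm

end Inequalities

end AnonNet

/-! ### Assembly. -/

theorem theorem3 {K : ℕ} {Y : Type*} [Finite Y] (y0 : Y) (h : stdSimplex ℝ (Fin K) → Y)
    (hlevel : ∀ y : Y, AnonNet.IsRatPolyhedral {p | h p = y}) :
    AnonNet.IsComputable y0 h := by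
  classical
  obtain ⟨ι, _, W, hW⟩ := AnonNet.exists_weights_of_isRatPolyhedral h hlevel
  have := Fintype.ofFinite ι
  let B : ℕ := ∑ c, ∑ k, (W c k).natAbs
  have hB : ∀ c k, |W c k| ≤ B := by
    intro c k
    have h1 : (W c k).natAbs ≤ ∑ k, (W c k).natAbs :=
      Finset.single_le_sum (f := fun k => (W c k).natAbs) (fun _ _ => Nat.zero_le _)
        (Finset.mem_univ k)
    have h2 : ∑ k, (W c k).natAbs ≤ B :=
      Finset.single_le_sum (f := fun c => ∑ k, (W c k).natAbs) (fun _ _ => Nat.zero_le _)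
        (Finset.mem_univ c)
    rw [Int.abs_eq_natAbs]
    exact_mod_cast h1.trans h2
  -- Any input realizing the sign pattern `σ` gives the same value of `h`, so one is chosen; `y0`
  -- serves patterns that never occur.
  let out : (ι → Bool) → Y := fun σ =>
    if hσ : ∃ y, ∃ (n : ℕ) (hn : 0 < n) (x : Fin n → Fin K),
        (fun c => decide (∑ i, W c (x i) ≤ 0)) = σ ∧ h ⟨AnonNet.freq x, AnonNet.freq_mem hn x⟩ = y
    then hσ.choose else y0
  have hout : ∀ (n : ℕ) (hn : 0 < n) (x : Fin n → Fin K),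
      out (fun c => decide (∑ i, W c (x i) ≤ 0)) =
        h ⟨AnonNet.freq x, AnonNet.freq_mem hn x⟩ := by
    intro n hn x
    have hσ : ∃ y, ∃ (n' : ℕ) (hn' : 0 < n') (x' : Fin n' → Fin K),
        (fun c => decide (∑ i, W c (x' i) ≤ 0)) = (fun c => decide (∑ i, W c (x i) ≤ 0)) ∧
        h ⟨AnonNet.freq x', AnonNet.freq_mem hn' x'⟩ = y := ⟨_, n, hn, x, rfl, rfl⟩
    simp only [out]
    rw [dif_pos hσ]
    obtain ⟨n', hn', x', h1, h2⟩ := hσ.choose_spec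
    rw [← h2]
    exact hW n' n hn' hn x' x fun c => decide_eq_decide.1 (congrFun h1 c)
  refine ⟨fun n x => out fun c => decide (∑ i, W c (x i) ≤ 0), hout,
    AnonNet.signAutomaton W B out, ?_⟩
  intro n G _ hG port x
  exact AnonNet.signAutomaton_isFinalOutput hB G hG port x
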